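/- **Setting.** We work in synthetic differential geometry: in a Grothendieck topos $\mathrm{Sh}(C,J)$ (all notions below are read in its internal logic, i.e. by Kripke–Joyal semantics), with a commutative ring object $R\supseteq\mathbb Q$ satisfying the general Kock–Lawvere axiom: for every Weil algebra $W=\mathbb Q[X_1,\dots,X_n]/I$, every map $\operatorname{Spec}_R W\to R$ is given by a polynomial with coefficients in $R$, unique modulo $I$. Put $D(R^n)=\{d\in R^n : d_id_j=0 \text{ for all } i,j\}$, and for $x,y\in R^n$ write $x\sim y$ if $y-x\in D(R^n)$. A subset is formally open if it is closed under $\sim$. Let $M$ be a formal manifold: $M$ has a reflexive symmetric relation $\sim$ (first order neighbours), and every point of $M$ lies in a formally open subset which is isomorphic, compatibly with $\sim$, to a formally open subset of some $R^n$. An $n$-path from $x$ to $y$ is a sequence $x=x_0\sim x_1\sim\dots\sim x_n=y$. Write $x\sim_\infty y$ if there is an $n$-path from $x$ to $y$ for some $n$. Assume that $M$ is path connected, i.e. $x\sim_\infty y$ for all $x,y\in M$. An *affine connection* with respect to a reflexive symmetric relation $\sim$ on $M$ is a map $\lambda:(x,y,z)\mapsto[zxy]\in M$, defined whenever $x\sim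 y$ and $x\sim z$, such that $[zxy]\sim y$, $[zxy]\sim z$, $[zxx]=z$, $[xxy]=y$ and $[[zxy]yx]=z$. It is *symmetric* if $[zxy]=[yxz]$, and *flat* if $[[zxy]yt]=[zxt]$ whenever $x,y,t$ are mutual neighbours and $z\sim x$. Let $\lambda$ be a symmetric and flat affine connection on $M$ with respect to the first order neighbour relation $\sim$. Paths $(x,z_1,\dots,z_m)$ and $(x,y_1,\dots,y_n)$ with common domain $x$ span a grid $u_{i,j}$ ($0\le i\le m$, $0\le j\le n$) by $u_{0,0}=x$, $u_{i,0}=z_i$, $u_{0,j}=y_j$, $u_{i+1,j+1}=[u_{i+1,j}\,u_{i,j}\,u_{i,j+1}]$; the point $u_{m,n}$ is its codomain. **Proposition 3.2.** There is a unique map $M\times M\times M\to M$, $(x,y,z)\mapsto z+_xy$, such that, for all paths from $x$ to $z$ and from $x$ to $y$, the codomain of the grid they span is $z+_xy$. For fixed $x$, the binary operation $+_x$ is commutative and has $x$ as a unit. The ternary operation $(x,y,z)\mapsto z+_xy$ is a symmetric affine connection with respect to the trivial neighbour relation $\sim_\infty$ on $M$ (so it is everywhere defined, and $(z+_xy)+_yx=z$),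 and it extends $\lambda$: $z+_xy=[zxy]$ whenever $z\sim x\sim y$. -/

import Mathlib

open CategoryTheory Opposite

universe v u w r

/-!
The ambient universe of synthetic differential geometry is the Grothendieck topos of sheaves on an
arbitrary site `(C, J)`.  Internal notions are spelled out by Kripke-Joyal forcing: an element of a
sheaf `M` in context `c` is an element of `M(c)`, a universally quantified statement is a statement
about all contexts, and "there exists" means "there exists locally, on a covering sieve".
-/

namespace SDG

variable {C : Type u} [Category.{v} C]

/-- The elements of `M` in context `c`. -/
abbrev El (M : Cᵒᵖ ⥤ Type w) (c : C) : Type w := M.obj (op c)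

/-- Restriction of an element along a change of context. -/
abbrev res {M : Cᵒᵖ ⥤ Type w} {c c' : C} (g : c' ⟶ c) (x : El M c) : El M c' := M.map g.op x

theorem res_res {M : Cᵒᵖ ⥤ Type w} {c c' c'' : C} (g : c' ⟶ c) (h : c'' ⟶ c') (x : El M c) :
    res h (res g x) = res (h ≫ g) x := by
  simp [res]

/-! ### The line and the Kock-Lawvere axiom -/

/-- The elements in context `c` of the ring object `R`. -/
abbrev Line (R : Cᵒᵖ ⥤ CommAlgCat.{r} ℚ) (c : C) : Type r := R.obj (op c)

/-- Restriction of scalars of the line along a change of context, an algebra map. -/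
abbrev lineRes (R : Cᵒᵖ ⥤ CommAlgCat.{r} ℚ) {c c' : C} (g : c' ⟶ c) : Line R c →ₐ[ℚ] Line R c' :=
  (R.map g.op).hom

/-- `ℚ[X]/I` is a Weil algebra over `ℚ`: it is the sum of `ℚ` and the ideal generated by the
variables, and the latter is nilpotent. -/
def IsWeilIdeal {σ : Type} (I : Ideal (MvPolynomial σ ℚ)) : Prop :=
  I ≤ Ideal.span (Set.range MvPolynomial.X) ∧
    ∃ k : ℕ, Ideal.span (Set.range (MvPolynomial.X : σ → MvPolynomial σ ℚ)) ^ k ≤ I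

/-- The infinitesimal object `Spec_R (ℚ[X]/I)`, the zero set of `I` in a power of the line. -/
def InSpec (R : Cᵒᵖ ⥤ CommAlgCat.{r} ℚ) {σ : Type} (I : Ideal (MvPolynomial σ ℚ)) {c : C}
    (d : σ → Line R c) : Prop :=
  ∀ p ∈ I, MvPolynomial.aeval d p = 0

/-- A map, in context `c`, from `Spec_R (ℚ[X]/I)` to the line. -/
structure SpecFun (R : Cᵒᵖ ⥤ CommAlgCat.{r} ℚ) {σ : Type} (I : Ideal (MvPolynomial σ ℚ))
    (c : C) where
  /-- the values, in all later contexts -/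
  val : ∀ {c' : C}, (c' ⟶ c) → ∀ d : σ → Line R c', InSpec R I d → Line R c'
  /-- compatibility with change of context -/
  val_res : ∀ {c' c'' : C} (g : c' ⟶ c) (h : c'' ⟶ c') (d : σ → Line R c') (hd : InSpec R I d)
    (hd' : InSpec R I fun i => lineRes R h (d i)),
    val (h ≫ g) (fun i => lineRes R h (d i)) hd' = lineRes R h (val g d hd)

/-- The value at `d`, in a later context, of a polynomial with coefficients in context `c`. -/
noncomputable def polyVal (R : Cᵒᵖ ⥤ CommAlgCat.{r} ℚ) {σ : Type} {c c' : C} (g : c' ⟶ c)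
    (P : MvPolynomial σ (Line R c)) (d : σ → Line R c') : Line R c' :=
  MvPolynomial.eval₂ (lineRes R g).toRingHom d P

/-- The general Kock-Lawvere axiom: for every Weil algebra `W = ℚ[X]/I` the canonical map
`R ⊗ W → R ^ (Spec_R W)` is a bijection.  That is, every map `Spec_R W → R` is given by a
polynomial with coefficients in `R`, and this polynomial is unique modulo `I`. -/
def KockLawvere (R : Cᵒᵖ ⥤ CommAlgCat.{r} ℚ) : Prop :=
  ∀ (σ : Type) [Finite σ] (I : Ideal (MvPolynomial σ ℚ)), IsWeilIdeal I → ∀ c : C,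
    (∀ f : SpecFun R I c, ∃ P : MvPolynomial σ (Line R c),
      ∀ (c' : C) (g : c' ⟶ c) (d : σ → Line R c') (hd : InSpec R I d),
        f.val g d hd = polyVal R g P d) ∧
    (∀ P : MvPolynomial σ (Line R c),
      (∀ (c' : C) (g : c' ⟶ c) (d : σ → Line R c'), InSpec R I d → polyVal R g P d = 0) →
        P ∈ I.map (MvPolynomial.map (algebraMap ℚ (Line R c))))

/-- Membership in `D(R ^ n)`: all products of two coordinates vanish. -/
def IsSmall (R : Cᵒᵖ ⥤ CommAlgCat.{r} ℚ) {n : ℕ} {c : C} (d : Fin n → Line R c) : Prop :=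
  ∀ i j, d i * d j = 0

/-! ### Neighbour relations and paths -/

/-- A reflexive symmetric relation on `M` in the internal sense, i.e. a reflexive symmetric
subsheaf of `M × M`. -/
structure NeighbourRelation (J : GrothendieckTopology C) (M : Cᵒᵖ ⥤ Type w) where
  /-- the relation, in every context -/
  rel : ∀ {c : C}, El M c → El M c → Prop
  refl : ∀ {c : C} (x : El M c), rel x x
  symm : ∀ {c : C} {x y : El M c}, rel x y → rel y x
  rel_res : ∀ {c c' : C} (g : c' ⟶ c) {x y : El M c}, rel x y → rel (res g x) (res g y)
  rel_local : ∀ {c : C} (x y : El M c) (S : Sieve c), S ∈ J c →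
    (∀ (c' : C) (g : c' ⟶ c), S g → rel (res g x) (res g y)) → rel x y

namespace NeighbourRelation

variable {J : GrothendieckTopology C} {M : Cᵒᵖ ⥤ Type w} (N : NeighbourRelation J M)

/-- `p` is an `n`-path from `x` to `y`. -/
structure IsPath {c : C} {n : ℕ} (p : Fin (n + 1) → El M c) (x y : El M c) : Prop where
  dom : p 0 = x
  codom : p (Fin.last n) = y
  step : ∀ i : Fin n, N.rel (p i.castSucc) (p i.succ)

/-- The sieve of all changes of context after which `x` and `y` are joined by some path. -/
def pathSieve {c : C} (x y : El M c) : Sieve c where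
  arrows c' g := ∃ (n : ℕ) (p : Fin (n + 1) → El M c'), N.IsPath p (res g x) (res g y)
  downward_closed := by
    rintro c' c'' g ⟨n, p, hp⟩ h
    refine ⟨n, fun i => res h (p i), ?_, ?_, fun i => N.rel_res h (hp.step i)⟩
    · rw [hp.dom, res_res]
    · rw [hp.codom, res_res]

/-- The internal transitive closure of the neighbour relation: `x` and `y` are joined, locally,
by an `n`-path for some `n`. -/
def infinity : NeighbourRelation J M where
  rel {c} x y := N.pathSieve x y ∈ J c
  refl {c} x := J.superset_covering
    (fun c' g _ => ⟨0, fun _ => res g x, rfl, rfl, fun i => i.elim0⟩) (J.top_mem c)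
  symm {c x y} h := by
    refine J.superset_covering ?_ h
    rintro c' g ⟨n, p, hp⟩
    refine ⟨n, fun i => p i.rev, ?_, ?_, fun i => ?_⟩
    · simpa using hp.codom
    · simpa using hp.dom
    · have := N.symm (hp.step i.rev)
      rwa [← Fin.rev_castSucc, ← Fin.rev_succ] at this
  rel_res {c c'} g {x y} h := by
    refine J.superset_covering ?_ (J.pullback_stable g h)
    rintro c'' k ⟨n, p, hp⟩
    exact ⟨n, p, by rw [hp.dom, res_res], by rw [hp.codom, res_res], hp.step⟩
  rel_local {c} x y S hS h := by
    refine J.transitive hS _ fun c' g hg => J.superset_covering ?_ (h c' g hg)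
    rintro c'' k ⟨n, p, hp⟩
    exact ⟨n, p, by rw [hp.dom, res_res], by rw [hp.codom, res_res], hp.step⟩

/-- `M` is path connected: any two points are joined by an `n`-path, for some `n`. -/
def PathConnected : Prop := ∀ {c : C} (x y : El M c), N.infinity.rel x y

end NeighbourRelation

/-! ### Formal manifolds -/

/-- A chart of `M` in context `c`: an isomorphism `coord` from a formally open subobject `dom` of
`M` onto a formally open subobject of `R ^ dim`.  The neighbour relation is, in the chart, the
one of `R ^ dim`. -/
structure Chart {J : GrothendieckTopology C} (R : Cᵒᵖ ⥤ CommAlgCat.{r} ℚ) {M : Cᵒᵖ ⥤ Type w}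
    (N : NeighbourRelation J M) (c : C) where
  /-- the dimension of the chart -/
  dim : ℕ
  /-- the domain -/
  dom : ∀ {c' : C}, (c' ⟶ c) → El M c' → Prop
  dom_res : ∀ {c' c'' : C} (g : c' ⟶ c) (h : c'' ⟶ c') {y : El M c'},
    dom g y → dom (h ≫ g) (res h y)
  dom_local : ∀ {c' : C} (g : c' ⟶ c) (y : El M c') (S : Sieve c'), S ∈ J c' →
    (∀ (c'' : C) (h : c'' ⟶ c'), S h → dom (h ≫ g) (res h y)) → dom g y
  dom_open : ∀ {c' : C} (g : c' ⟶ c) {y z : El M c'}, dom g y → N.rel y z → dom g z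
  /-- the coordinates of the points of the domain -/
  coord : ∀ {c' : C} (g : c' ⟶ c) (y : El M c'), dom g y → Fin dim → Line R c'
  coord_res : ∀ {c' c'' : C} (g : c' ⟶ c) (h : c'' ⟶ c') (y : El M c') (hy : dom g y)
    (hy' : dom (h ≫ g) (res h y)) (i : Fin dim),
    coord (h ≫ g) (res h y) hy' i = lineRes R h (coord g y hy i)
  coord_injective : ∀ {c' : C} (g : c' ⟶ c) (y z : El M c') (hy : dom g y) (hz : dom g z),
    coord g y hy = coord g z hz → y = z
  image_open : ∀ {c' : C} (g : c' ⟶ c) (y : El M c') (hy : dom g y) (d : Fin dim → Line R c'),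
    IsSmall R d → ∃ (z : El M c') (hz : dom g z), coord g z hz = coord g y hy + d
  rel_iff : ∀ {c' : C} (g : c' ⟶ c) (y z : El M c') (hy : dom g y) (hz : dom g z),
    N.rel y z ↔ IsSmall R (coord g z hz - coord g y hy)

/-- `M`, with its first order neighbour relation, is a formal manifold: locally, every point is
in the domain of a chart. -/
def IsFormalManifold {J : GrothendieckTopology C} (R : Cᵒᵖ ⥤ CommAlgCat.{r} ℚ)
    {M : Cᵒᵖ ⥤ Type w} (N : NeighbourRelation J M) : Prop :=
  ∀ (c : C) (x : El M c), ∃ S ∈ J c, ∀ (c' : C) (g : c' ⟶ c), S g →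
    ∃ χ : Chart R N c', χ.dom (𝟙 c') (res g x)

/-! ### Affine connections -/

/-- An affine connection on `M` with respect to a neighbour relation: `op z x y`, written `[zxy]`
in the comments, is defined when `x ∼ y` and `x ∼ z`. -/
structure AffineConnection {J : GrothendieckTopology C} {M : Cᵒᵖ ⥤ Type w}
    (N : NeighbourRelation J M) where
  /-- the point `[zxy]` -/
  op : ∀ {c : C} (z x y : El M c), N.rel x y → N.rel x z → El M c
  op_res : ∀ {c c' : C} (g : c' ⟶ c) (z x y : El M c) (hy : N.rel x y) (hz : N.rel x z),
    res g (op z x y hy hz) = op (res g z) (res g x) (res g y) (N.rel_res g hy) (N.rel_res g hz)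
  /-- `[zxy] ∼ y` -/
  rel_right : ∀ {c : C} (z x y : El M c) (hy : N.rel x y) (hz : N.rel x z),
    N.rel (op z x y hy hz) y
  /-- `[zxy] ∼ z` -/
  rel_left : ∀ {c : C} (z x y : El M c) (hy : N.rel x y) (hz : N.rel x z),
    N.rel (op z x y hy hz) z
  /-- `[zxx] = z` -/
  unit_right : ∀ {c : C} (z x : El M c) (hz : N.rel x z), op z x x (N.refl x) hz = z
  /-- `[xxy] = y` -/
  unit_left : ∀ {c : C} (x y : El M c) (hy : N.rel x y), op x x y hy (N.refl x) = y
  /-- `[[zxy]yx] = z` -/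
  inversion : ∀ {c : C} (z x y : El M c) (hy : N.rel x y) (hz : N.rel x z),
    op (op z x y hy hz) y x (N.symm hy) (N.symm (rel_right z x y hy hz)) = z

/-- A globally defined ternary operation on `M`, i.e. a map of sheaves `M × M × M → M`;
`op z x y` is to be read as `z +ₓ y`. -/
@[ext]
structure GlobalOp (M : Cᵒᵖ ⥤ Type w) where
  op : ∀ {c : C}, El M c → El M c → El M c → El M c
  op_res : ∀ {c c' : C} (g : c' ⟶ c) (z x y : El M c),
    res g (op z x y) = op (res g z) (res g x) (res g y)

namespace AffineConnection

variable {J : GrothendieckTopology C} {M : Cᵒᵖ ⥤ Type w} {N : NeighbourRelation J M}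
  (lam : AffineConnection N)

/-- `[zxy] = [yxz]` -/
def IsSymmetric : Prop :=
  ∀ {c : C} (z x y : El M c) (hy : N.rel x y) (hz : N.rel x z),
    lam.op z x y hy hz = lam.op y x z hz hy

/-- The connection in the groupoid of bijections between monads which is given by `lam`:
the map `z ↦ [zxy]` from the monad of `x` to the monad of `y`. -/
def transport {c : C} {x y : El M c} (hy : N.rel x y) (z : {z : El M c // N.rel x z}) :
    {z : El M c // N.rel y z} :=
  ⟨lam.op z x y hy z.2, N.symm (lam.rel_right z x y hy z.2)⟩

/-- The connection is flat: for mutual neighbours `x`, `y`, `t`, transport from `x` to `y` followed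
by transport from `y` to `t` is transport from `x` to `t`. -/
def IsFlat : Prop :=
  ∀ {c : C} {x y t : El M c} (hxy : N.rel x y) (hyt : N.rel y t) (hxt : N.rel x t)
    (z : {z : El M c // N.rel x z}),
    lam.transport hyt (lam.transport hxy z) = lam.transport hxt z

/-- `grid` is the two-dimensional grid which is spanned by the paths `zs` (first index) and
`ys` (second index) by means of `lam`. -/
structure IsGrid {c : C} {m n : ℕ} (zs : Fin (m + 1) → El M c) (ys : Fin (n + 1) → El M c)
    (grid : Fin (m + 1) → Fin (n + 1) → El M c) : Prop where
  left : ∀ i, grid i 0 = zs i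
  top : ∀ j, grid 0 j = ys j
  step : ∀ (i : Fin m) (j : Fin n),
    ∃ (hy : N.rel (grid i.castSucc j.castSucc) (grid i.castSucc j.succ))
      (hz : N.rel (grid i.castSucc j.castSucc) (grid i.succ j.castSucc)),
      grid i.succ j.succ =
        lam.op (grid i.succ j.castSucc) (grid i.castSucc j.castSucc) (grid i.castSucc j.succ) hy hz

/-- `add` is the operation `z +ₓ y` given by the codomains of grids: any path from `x` to `z` and
any path from `x` to `y` span a grid, and `z +ₓ y` is its codomain.  When any two points
are locally joined by paths there is at most one such `add` on a sheaf. -/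
def IsGridSum (add : GlobalOp M) : Prop :=
  ∀ {c : C} (z x y : El M c) {m n : ℕ} (zs : Fin (m + 1) → El M c) (ys : Fin (n + 1) → El M c),
    N.IsPath zs x z → N.IsPath ys x y →
      ∃ grid : Fin (m + 1) → Fin (n + 1) → El M c,
        lam.IsGrid zs ys grid ∧ grid (Fin.last m) (Fin.last n) = add.op z x y

end AffineConnection

end SDG

namespace SDG

/-! ### Symmetric functions of square-zero vectors -/

section Algebra

variable {A : Type*} [CommRing A] {κ : Type*} {n : ℕ}

/-! The heart of the matter is that transport along a path depends only on the end points of the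
path (`trSeq_eq_of_isFlat`). Equality is local and chart domains are formally open, so the whole
path may be taken inside one chart and described by its displacements `d₁, …, dₙ ∈ D(R^k)`. By
Kock-Lawvere, each coordinate of the transported point is a polynomial in these displacements
(`exists_polyVal_walk`).

Flatness says that two displacements `d`, `e` can be exchanged when `d + e` is also small. Hence the
antisymmetrization of the polynomial for two steps lies in the ideal expressing that `d`, `e`, `d +
e` are small. On all pairs of small vectors, members of that ideal are symmetric
(`eval₂_swap_of_mem_flatIdeal`). The antisymmetrization is therefore equal to its own negative and
vanishes, so any two displacements can be exchanged (`walk_swap`) and the polynomial for `n` steps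
is permutation invariant. Over `ℚ`, such a function of small vectors depends only on their sum
(`eval₂_eq_of_sum_eq`), and the displacements of a path sum to the difference of its end points.

Each row of a grid is a transport along the previous row, so by induction the codomain depends only
on the end points of the second path; symmetry of the connection transposes the grid and gives the
same for the first path. Codomains therefore glue to a global operation, and its laws are read off
from transposed, degenerate and reversed grids. -/

theorem sum_perm_cons_of_mem (d : Fin n → κ → A) (hd : ∀ a i j, d a i * d a j = 0)
    (l : List (Fin n × κ)) (b : Fin n) (j : κ) (hb : b ∈ l.map Prod.fst) (π : Equiv.Perm (Fin n)) :
    d (π b) j * (l.map fun p => d (π p.1) p.2).prod = 0 := by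
  obtain ⟨⟨b', i⟩, hp, rfl⟩ := List.mem_map.1 hb
  obtain ⟨t, ht⟩ := List.dvd_prod (List.mem_map_of_mem (f := fun p => d (π p.1) p.2) hp)
  rw [ht, ← mul_assoc, hd, zero_mul]

/-- Expand `∑ a, d a j` as `∑ a, d (π a) j`. Indices `a` occurring in `l` contribute zero. For each
other `a`, precomposing `π` with the transposition of `a` and `b`, which fixes the indices in `l`,
turns its contribution into that of `b`; the cardinality counts these equal terms. -/
theorem sum_perm_cons_of_notMem (d : Fin n → κ → A) (hd : ∀ a i j, d a i * d a j = 0)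
    (l : List (Fin n × κ)) (b : Fin n) (j : κ) (hb : b ∉ l.map Prod.fst) :
    ((((l.map Prod.fst).toFinset)ᶜ.card : ℕ) : A) *
        ∑ π : Equiv.Perm (Fin n), d (π b) j * (l.map fun p => d (π p.1) p.2).prod =
      (∑ a, d a j) * ∑ π : Equiv.Perm (Fin n), (l.map fun p => d (π p.1) p.2).prod := by
  symm
  calc (∑ a, d a j) * ∑ π : Equiv.Perm (Fin n), (l.map fun p => d (π p.1) p.2).prod
      = ∑ π : Equiv.Perm (Fin n), ∑ a, d (π a) j * (l.map fun p => d (π p.1) p.2).prod := by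
        rw [Finset.mul_sum]
        refine Finset.sum_congr rfl fun π _ => ?_
        rw [← Finset.sum_mul, Equiv.sum_comp π fun a => d a j]
    _ = ∑ a, ∑ π : Equiv.Perm (Fin n), d (π a) j * (l.map fun p => d (π p.1) p.2).prod :=
        Finset.sum_comm
    _ = ∑ a ∈ ((l.map Prod.fst).toFinset)ᶜ,
          ∑ π : Equiv.Perm (Fin n), d (π a) j * (l.map fun p => d (π p.1) p.2).prod := by
        refine (Finset.sum_subset (Finset.subset_univ _) fun a _ ha => ?_).symm
        refine Finset.sum_eq_zero fun π _ => sum_perm_cons_of_mem d hd l a j ?_ π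
        simpa using ha
    _ = ∑ a ∈ ((l.map Prod.fst).toFinset)ᶜ,
          ∑ π : Equiv.Perm (Fin n), d (π b) j * (l.map fun p => d (π p.1) p.2).prod := by
        refine Finset.sum_congr rfl fun a ha => ?_
        have ha' : a ∉ l.map Prod.fst := by simpa using ha
        rw [← Equiv.sum_comp (Equiv.mulRight (Equiv.swap a b))]
        refine Finset.sum_congr rfl fun π _ => ?_
        simp only [Equiv.coe_mulRight, Equiv.Perm.mul_apply, Equiv.swap_apply_left]
        congr 2
        refine List.map_congr_left fun p hp => ?_
        have hp' := List.mem_map_of_mem (f := Prod.fst) hp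
        rw [Equiv.swap_apply_of_ne_of_ne] <;> rintro rfl <;> contradiction
    _ = _ := by simp

/-- Factors are split off one at a time: each new index contributes the common sum of the vectors,
up to the number of unused indices, which is invertible because `b` is one of them. -/
theorem sum_perm_list_prod_eq [Algebra ℚ A] (d d' : Fin n → κ → A)
    (hd : ∀ a i j, d a i * d a j = 0) (hd' : ∀ a i j, d' a i * d' a j = 0)
    (hs : ∀ j, ∑ a, d a j = ∑ a, d' a j) (l : List (Fin n × κ)) :
    ∑ π : Equiv.Perm (Fin n), (l.map fun p => d (π p.1) p.2).prod =
      ∑ π : Equiv.Perm (Fin n), (l.map fun p => d' (π p.1) p.2).prod := by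
  induction l with
  | nil => simp
  | cons p l ih =>
    obtain ⟨b, j⟩ := p
    simp only [List.map_cons, List.prod_cons]
    by_cases hb : b ∈ l.map Prod.fst
    · rw [Finset.sum_eq_zero fun π _ => sum_perm_cons_of_mem d hd l b j hb π,
        Finset.sum_eq_zero fun π _ => sum_perm_cons_of_mem d' hd' l b j hb π]
    · have h1 := sum_perm_cons_of_notMem d hd l b j hb
      have h2 := sum_perm_cons_of_notMem d' hd' l b j hb
      rw [ih, hs j, ← h2] at h1
      have hu : IsUnit ((((l.map Prod.fst).toFinset)ᶜ.card : ℕ) : A) := by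
        have h0 : (((l.map Prod.fst).toFinset)ᶜ.card : ℚ) ≠ 0 := by
          rw [Nat.cast_ne_zero, Finset.card_ne_zero]
          exact ⟨b, by simpa using hb⟩
        simpa using (IsUnit.mk0 _ h0).map (algebraMap ℚ A)
      exact hu.mul_left_cancel h1

/-- The additional monomial `l` is what makes induction on `P` work: multiplication by a variable is
absorbed into `l`, leaving only the case of monomials. -/
theorem sum_perm_eval₂_mul_eq {B : Type*} [CommRing B] [Algebra ℚ A] (φ : B →+* A)
    (d d' : Fin n → κ → A)
    (hd : ∀ a i j, d a i * d a j = 0) (hd' : ∀ a i j, d' a i * d' a j = 0)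
    (hs : ∀ j, ∑ a, d a j = ∑ a, d' a j) (P : MvPolynomial (Fin n × κ) B)
    (l : List (Fin n × κ)) :
    ∑ π : Equiv.Perm (Fin n), P.eval₂ φ (fun p => d (π p.1) p.2) *
        (l.map fun p => d (π p.1) p.2).prod =
      ∑ π : Equiv.Perm (Fin n), P.eval₂ φ (fun p => d' (π p.1) p.2) *
        (l.map fun p => d' (π p.1) p.2).prod := by
  induction P using MvPolynomial.induction_on generalizing l with
  | C a =>
    simp only [MvPolynomial.eval₂_C, ← Finset.mul_sum]
    rw [sum_perm_list_prod_eq d d' hd hd' hs]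
  | add p q hp hq =>
    simp only [MvPolynomial.eval₂_add, add_mul, Finset.sum_add_distrib, hp, hq]
  | mul_X p x hp =>
    simpa [mul_assoc] using hp (x :: l)

/-- On square-zero vectors, a polynomial function which is invariant under permutations depends
only on the sum of the vectors. -/
theorem eval₂_eq_of_sum_eq {B : Type*} [CommRing B] [Algebra ℚ A] (φ : B →+* A)
    (d d' : Fin n → κ → A)
    (hd : ∀ a i j, d a i * d a j = 0) (hd' : ∀ a i j, d' a i * d' a j = 0)
    (hs : ∀ j, ∑ a, d a j = ∑ a, d' a j) (P : MvPolynomial (Fin n × κ) B)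
    (hP : ∀ π : Equiv.Perm (Fin n),
      P.eval₂ φ (fun p => d (π p.1) p.2) = P.eval₂ φ (fun p => d p.1 p.2))
    (hP' : ∀ π : Equiv.Perm (Fin n),
      P.eval₂ φ (fun p => d' (π p.1) p.2) = P.eval₂ φ (fun p => d' p.1 p.2)) :
    P.eval₂ φ (fun p => d p.1 p.2) = P.eval₂ φ (fun p => d' p.1 p.2) := by
  -- By invariance, both sums over permutations are the number of permutations times the value in
  -- question.
  have h := sum_perm_eval₂_mul_eq φ d d' hd hd' hs P []
  simp only [hP, hP', List.map_nil, List.prod_nil, mul_one, Finset.sum_const, nsmul_eq_mul] at h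
  have hu : IsUnit (((Finset.univ : Finset (Equiv.Perm (Fin n))).card : ℕ) : A) := by
    have h0 : ((Finset.univ : Finset (Equiv.Perm (Fin n))).card : ℚ) ≠ 0 := by
      rw [Nat.cast_ne_zero, Finset.card_ne_zero]
      exact Finset.univ_nonempty
    simpa using (IsUnit.mk0 _ h0).map (algebraMap ℚ A)
  exact hu.mul_left_cancel h

end Algebra

/-! ### Weil ideals -/

open MvPolynomial in
/-- The ideal of `n`-tuples of vectors whose coordinates have vanishing products. -/
noncomputable def squareIdeal (n : ℕ) (κ : Type) : Ideal (MvPolynomial (Fin n × κ) ℚ) :=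
  Ideal.span {p | ∃ a i j, p = X (a, i) * X (a, j)}

open MvPolynomial in
/-- The ideal of pairs of small vectors with small sum. -/
noncomputable def flatIdeal (κ : Type) : Ideal (MvPolynomial (Fin 2 × κ) ℚ) :=
  Ideal.span ({p | ∃ a i j, p = X (a, i) * X (a, j)} ∪
    {p | ∃ i j, p = X (0, i) * X (1, j) + X (0, j) * X (1, i)})

/-- The square of every variable lies in `I`, so the finitely generated ideal of the variables lies
in the radical of `I`. -/
theorem isWeilIdeal_of_squareIdeal_le {n : ℕ} {κ : Type} [Finite κ]
    {I : Ideal (MvPolynomial (Fin n × κ) ℚ)} (h : squareIdeal n κ ≤ I)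
    (hI : I ≤ Ideal.span (Set.range MvPolynomial.X)) : IsWeilIdeal I := by
  refine ⟨hI, Ideal.exists_pow_le_of_le_radical_of_fg ?_ ?_⟩
  · rw [Ideal.span_le]
    rintro _ ⟨⟨a, i⟩, rfl⟩
    exact ⟨2, h (Ideal.subset_span ⟨a, i, i, sq _⟩)⟩
  · exact Submodule.fg_span (Set.finite_range _)

theorem isWeilIdeal_squareIdeal (n : ℕ) (κ : Type) [Finite κ] : IsWeilIdeal (squareIdeal n κ) := by
  refine isWeilIdeal_of_squareIdeal_le le_rfl ?_
  rw [squareIdeal, Ideal.span_le]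
  rintro _ ⟨a, i, j, rfl⟩
  exact Ideal.mul_mem_left _ _ (Ideal.subset_span ⟨_, rfl⟩)

theorem isWeilIdeal_flatIdeal (κ : Type) [Finite κ] : IsWeilIdeal (flatIdeal κ) := by
  refine isWeilIdeal_of_squareIdeal_le (Ideal.span_mono Set.subset_union_left) ?_
  rw [flatIdeal, Ideal.span_le]
  rintro _ (⟨a, i, j, rfl⟩ | ⟨i, j, rfl⟩)
  · exact Ideal.mul_mem_left _ _ (Ideal.subset_span ⟨_, rfl⟩)
  · exact Ideal.add_mem _ (Ideal.mul_mem_left _ _ (Ideal.subset_span ⟨_, rfl⟩))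
      (Ideal.mul_mem_left _ _ (Ideal.subset_span ⟨_, rfl⟩))

/-- If all variables annihilate `q`, only the constant term of `P` contributes to the product. -/
theorem eval₂_mul_eq_of_killed {A B σ : Type*} [CommRing A] [CommRing B] (φ : B →+* A)
    (d d' : σ → A) (q : A) (h : ∀ s, d s * q = 0) (h' : ∀ s, d' s * q = 0)
    (P : MvPolynomial σ B) : P.eval₂ φ d * q = P.eval₂ φ d' * q := by
  induction P using MvPolynomial.induction_on with
  | C a => simp
  | add p p' hp hp' => simp [add_mul, hp, hp']
  | mul_X p s _ => simp [mul_assoc, h, h']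

/-- Polynomials in the ideal of pairs of small vectors with small sum are symmetric functions of
pairs of small vectors. -/
theorem eval₂_swap_of_mem_flatIdeal {A B : Type*} [CommRing A] [CommRing B] [Algebra ℚ B]
    {κ : Type} (φ : B →+* A) (d e : κ → A) (hd : ∀ i j, d i * d j = 0) (he : ∀ i j, e i * e j = 0)
    (Q : MvPolynomial (Fin 2 × κ) B)
    (hQ : Q ∈ (flatIdeal κ).map (MvPolynomial.map (algebraMap ℚ B))) :
    Q.eval₂ φ (fun p => ![d, e] p.1 p.2) = Q.eval₂ φ (fun p => ![e, d] p.1 p.2) := by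
  rw [flatIdeal, Ideal.map_span] at hQ
  -- Symmetry alone is not stable under multiplication by arbitrary polynomials. It becomes so
  -- together with annihilation by all coordinates, since then only the constant term of the
  -- multiplier matters. The generators satisfy this because `d i * d j` and `e i * e j` vanish.
  suffices Q.eval₂ φ (fun p => ![d, e] p.1 p.2) = Q.eval₂ φ (fun p => ![e, d] p.1 p.2) ∧
      (∀ i, d i * Q.eval₂ φ (fun p => ![d, e] p.1 p.2) = 0) ∧
      (∀ i, e i * Q.eval₂ φ (fun p => ![d, e] p.1 p.2) = 0) from this.1
  induction hQ using Submodule.span_induction with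
  | mem Q hQ =>
    obtain ⟨_, ⟨a, i, j, rfl⟩ | ⟨i, j, rfl⟩, rfl⟩ := hQ
    · fin_cases a <;> simp [hd, he]
    · refine ⟨?_, fun k => ?_, fun k => ?_⟩
      · simp; ring
      · simp only [map_add, map_mul, MvPolynomial.map_X, MvPolynomial.eval₂_add,
          MvPolynomial.eval₂_mul, MvPolynomial.eval₂_X, Matrix.cons_val_zero, Matrix.cons_val_one]
        linear_combination e j * hd k i + e i * hd k j
      · simp only [map_add, map_mul, MvPolynomial.map_X, MvPolynomial.eval₂_add,
          MvPolynomial.eval₂_mul, MvPolynomial.eval₂_X, Matrix.cons_val_zero, Matrix.cons_val_one]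
        linear_combination d i * he k j + d j * he k i
  | zero => simp
  | add p q _ _ hp hq =>
    refine ⟨?_, fun i => ?_, fun i => ?_⟩
    · simp only [MvPolynomial.eval₂_add, hp.1, hq.1]
    · simp only [MvPolynomial.eval₂_add, mul_add, hp.2.1, hq.2.1, add_zero]
    · simp only [MvPolynomial.eval₂_add, mul_add, hp.2.2, hq.2.2, add_zero]
  | smul r p _ hp =>
    obtain ⟨h1, h2, h3⟩ := hp
    simp only [smul_eq_mul, MvPolynomial.eval₂_mul]
    refine ⟨?_, fun i => ?_, fun i => ?_⟩
    · rw [← h1]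
      refine eval₂_mul_eq_of_killed φ _ _ _ ?_ ?_ r <;> rintro ⟨a, i⟩ <;> fin_cases a
      exacts [h2 i, h3 i, h3 i, h2 i]
    · rw [mul_left_comm, h2, mul_zero]
    · rw [mul_left_comm, h3, mul_zero]

end SDG

namespace SDG

variable {C : Type u} [Category.{v} C] {J : GrothendieckTopology C}
  {R : Cᵒᵖ ⥤ CommAlgCat.{r} ℚ} {M : Cᵒᵖ ⥤ Type w} {N : NeighbourRelation J M}

theorem res_id {c : C} (x : El M c) : res (𝟙 c) x = x := by simp [res]

/-- Equality of elements of a sheaf is local. -/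
theorem ext_of_covering (hM : Presieve.IsSheaf J M) {c : C} {x y : El M c} (S : Sieve c)
    (hS : S ∈ J c) (h : ∀ (c' : C) (g : c' ⟶ c), S g → res g x = res g y) : x = y :=
  (hM S hS).isSeparatedFor.ext fun c' g hg => h c' g hg

theorem IsSmall.res {n : ℕ} {c c' : C} (h : c' ⟶ c) {d : Fin n → Line R c} (hd : IsSmall R d) :
    IsSmall R fun i => lineRes R h (d i) := fun i j => by
  rw [← map_mul, hd i j, map_zero]

/-! ### Coordinates and displacements in a chart -/

namespace Chart

variable {c : C} (χ : Chart R N c)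

open Classical in
/-- The coordinates of a point, with value zero outside the domain of the chart. -/
noncomputable def crd {c' : C} (f : c' ⟶ c) (y : El M c') : Fin χ.dim → Line R c' :=
  if h : χ.dom f y then χ.coord f y h else 0

theorem crd_eq {c' : C} (f : c' ⟶ c) {y : El M c'} (hy : χ.dom f y) :
    χ.crd f y = χ.coord f y hy := dif_pos hy

theorem crd_res {c' c'' : C} (f : c' ⟶ c) (h : c'' ⟶ c') {y : El M c'} (hy : χ.dom f y) :
    χ.crd (h ≫ f) (res h y) = fun i => lineRes R h (χ.crd f y i) := by
  funext i
  rw [χ.crd_eq f hy, χ.crd_eq _ (χ.dom_res f h hy), χ.coord_res f h y hy]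

theorem crd_injective {c' : C} (f : c' ⟶ c) {y z : El M c'} (hy : χ.dom f y) (hz : χ.dom f z)
    (h : χ.crd f y = χ.crd f z) : y = z := by
  rw [χ.crd_eq f hy, χ.crd_eq f hz] at h
  exact χ.coord_injective f y z hy hz h

theorem rel_iff_crd {c' : C} (f : c' ⟶ c) {y z : El M c'} (hy : χ.dom f y) (hz : χ.dom f z) :
    N.rel y z ↔ IsSmall R (χ.crd f z - χ.crd f y) := by
  rw [χ.crd_eq f hy, χ.crd_eq f hz, χ.rel_iff f y z hy hz]

theorem exists_shift {c' : C} (f : c' ⟶ c) {y : El M c'} (hy : χ.dom f y)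
    {d : Fin χ.dim → Line R c'} (hd : IsSmall R d) :
    ∃ z, χ.dom f z ∧ χ.crd f z = χ.crd f y + d := by
  obtain ⟨z, hz, h⟩ := χ.image_open f y hy d hd
  exact ⟨z, hz, by rw [χ.crd_eq f hy, χ.crd_eq f hz, h]⟩

open Classical in
/-- The point whose coordinates are those of `y`, displaced by `d`. -/
noncomputable def shift {c' : C} (f : c' ⟶ c) (y : El M c') (d : Fin χ.dim → Line R c') :
    El M c' :=
  if h : ∃ z, χ.dom f z ∧ χ.crd f z = χ.crd f y + d then h.choose else y

section shift

variable {c' : C} (f : c' ⟶ c) {y : El M c'} (hy : χ.dom f y) {d : Fin χ.dim → Line R c'}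
  (hd : IsSmall R d)

include hy hd

theorem dom_shift : χ.dom f (χ.shift f y d) := by
  have h := χ.exists_shift f hy hd
  rw [shift, dif_pos h]
  exact h.choose_spec.1

theorem crd_shift : χ.crd f (χ.shift f y d) = χ.crd f y + d := by
  have h := χ.exists_shift f hy hd
  rw [shift, dif_pos h]
  exact h.choose_spec.2

theorem rel_shift : N.rel y (χ.shift f y d) := by
  rw [χ.rel_iff_crd f hy (χ.dom_shift f hy hd), χ.crd_shift f hy hd]
  simpa using hd

theorem shift_res {c'' : C} (h : c'' ⟶ c') :
    res h (χ.shift f y d) = χ.shift (h ≫ f) (res h y) fun i => lineRes R h (d i) := by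
  have hy' := χ.dom_res f h hy
  refine χ.crd_injective (h ≫ f) (χ.dom_res f h (χ.dom_shift f hy hd))
    (χ.dom_shift (h ≫ f) hy' (hd.res h)) ?_
  rw [χ.crd_shift (h ≫ f) hy' (hd.res h), χ.crd_res f h (χ.dom_shift f hy hd),
    χ.crd_shift f hy hd, χ.crd_res f h hy]
  funext i
  simp

/-- Small vectors are not closed under addition; `hde` is what makes the single displacement on the
right meaningful. -/
theorem shift_shift {e : Fin χ.dim → Line R c'} (he : IsSmall R e) (hde : IsSmall R (d + e)) :
    χ.shift f (χ.shift f y d) e = χ.shift f y (d + e) := by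
  have h := χ.dom_shift f hy hd
  refine χ.crd_injective f (χ.dom_shift f h he) (χ.dom_shift f hy hde) ?_
  rw [χ.crd_shift f h he, χ.crd_shift f hy hd, χ.crd_shift f hy hde, add_assoc]

end shift

theorem shift_crd_sub {c' : C} (f : c' ⟶ c) {y z : El M c'} (hy : χ.dom f y) (h : N.rel y z) :
    χ.shift f y (χ.crd f z - χ.crd f y) = z := by
  have hz := χ.dom_open f hy h
  have hd := (χ.rel_iff_crd f hy hz).1 h
  refine χ.crd_injective f (χ.dom_shift f hy hd) hz ?_
  rw [χ.crd_shift f hy hd, add_sub_cancel]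

end Chart

/-! ### Transport along a path -/

namespace AffineConnection

variable (lam : AffineConnection N)

open Classical in
/-- The point `[zxy]`, with value `z` when it is not defined. -/
noncomputable def tr {c : C} (z x y : El M c) : El M c :=
  if h : N.rel x y ∧ N.rel x z then lam.op z x y h.1 h.2 else z

theorem tr_eq {c : C} {z x y : El M c} (hy : N.rel x y) (hz : N.rel x z) :
    lam.tr z x y = lam.op z x y hy hz := dif_pos ⟨hy, hz⟩

theorem tr_res {c c' : C} (g : c' ⟶ c) {z x y : El M c} (hy : N.rel x y) (hz : N.rel x z) :
    res g (lam.tr z x y) = lam.tr (res g z) (res g x) (res g y) := by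
  rw [lam.tr_eq hy hz, lam.tr_eq (N.rel_res g hy) (N.rel_res g hz), lam.op_res]

theorem rel_tr {c : C} {z x y : El M c} (hy : N.rel x y) (hz : N.rel x z) :
    N.rel y (lam.tr z x y) := by
  rw [lam.tr_eq hy hz]
  exact N.symm (lam.rel_right _ _ _ _ _)

theorem rel_tr_left {c : C} {z x y : El M c} (hy : N.rel x y) (hz : N.rel x z) :
    N.rel z (lam.tr z x y) := by
  rw [lam.tr_eq hy hz]
  exact N.symm (lam.rel_left _ _ _ _ _)

theorem tr_self {c : C} (z x : El M c) : lam.tr z x x = z := by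
  rw [tr]
  split_ifs with h
  · exact lam.unit_right _ _ _
  · rfl

theorem tr_tr_cancel {c : C} {z x y : El M c} (hy : N.rel x y) (hz : N.rel x z) :
    lam.tr (lam.tr z x y) y x = z := by
  have h := lam.rel_tr hy hz
  rw [lam.tr_eq (N.symm hy) h]
  simp only [lam.tr_eq hy hz, lam.inversion]

theorem tr_tr_of_isFlat {lam : AffineConnection N} (hflat : lam.IsFlat) {c : C}
    {z x y t : El M c} (hxy : N.rel x y) (hyt : N.rel y t) (hxt : N.rel x t) (hz : N.rel x z) :
    lam.tr (lam.tr z x y) y t = lam.tr z x t := by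
  have h := congrArg Subtype.val (hflat hxy hyt hxt ⟨z, hz⟩)
  rw [lam.tr_eq hyt (lam.rel_tr hxy hz), lam.tr_eq hxt hz]
  simp only [lam.tr_eq hxy hz]
  exact h

theorem tr_comm {lam : AffineConnection N} (hsymm : lam.IsSymmetric) {c : C}
    {z x y : El M c} (hy : N.rel x y) (hz : N.rel x z) : lam.tr z x y = lam.tr y x z := by
  rw [lam.tr_eq hy hz, lam.tr_eq hz hy, hsymm]

/-- The transports of `z` along the path `p`. -/
noncomputable def trSeq {c : C} (p : ℕ → El M c) (z : El M c) : ℕ → El M c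
  | 0 => z
  | i + 1 => lam.tr (trSeq p z i) (p i) (p (i + 1))

theorem rel_trSeq {c : C} {p : ℕ → El M c} (hp : ∀ i, N.rel (p i) (p (i + 1))) {z : El M c}
    (hz : N.rel (p 0) z) (i : ℕ) : N.rel (p i) (lam.trSeq p z i) := by
  induction i with
  | zero => exact hz
  | succ i ih => exact lam.rel_tr (hp i) ih

theorem rel_trSeq_succ {c : C} {p : ℕ → El M c} (hp : ∀ i, N.rel (p i) (p (i + 1)))
    {z : El M c} (hz : N.rel (p 0) z) (i : ℕ) :
    N.rel (lam.trSeq p z i) (lam.trSeq p z (i + 1)) :=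
  lam.rel_tr_left (hp i) (lam.rel_trSeq hp hz i)

theorem res_trSeq {c c' : C} (g : c' ⟶ c) {p : ℕ → El M c}
    (hp : ∀ i, N.rel (p i) (p (i + 1))) {z : El M c} (hz : N.rel (p 0) z) (i : ℕ) :
    res g (lam.trSeq p z i) = lam.trSeq (fun i => res g (p i)) (res g z) i := by
  induction i with
  | zero => rfl
  | succ i ih => rw [trSeq, lam.tr_res g (hp i) (lam.rel_trSeq hp hz i), ih, trSeq]

/-- Starting from the point `s.1` and its neighbour `s.2`, perform the displacements in a list one
after the other, and transport the neighbour along. -/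
noncomputable def walk {c : C} (χ : Chart R N c) {c' : C} (f : c' ⟶ c) (s : El M c' × El M c')
    (l : List (Fin χ.dim → Line R c')) : El M c' × El M c' :=
  l.foldl (fun s d => (χ.shift f s.1 d, lam.tr s.2 s.1 (χ.shift f s.1 d))) s

section walk

variable {c : C} (χ : Chart R N c) {c' : C} (f : c' ⟶ c)

theorem walk_cons (s : El M c' × El M c') (d : Fin χ.dim → Line R c')
    (l : List (Fin χ.dim → Line R c')) :
    lam.walk χ f s (d :: l) =
      lam.walk χ f (χ.shift f s.1 d, lam.tr s.2 s.1 (χ.shift f s.1 d)) l := rfl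

theorem walk_spec {s : El M c' × El M c'} (hs : χ.dom f s.1) (hs' : N.rel s.1 s.2)
    {l : List (Fin χ.dim → Line R c')} (hl : ∀ d ∈ l, IsSmall R d) :
    χ.dom f (lam.walk χ f s l).1 ∧ N.rel (lam.walk χ f s l).1 (lam.walk χ f s l).2 ∧
      χ.crd f (lam.walk χ f s l).1 = χ.crd f s.1 + l.sum := by
  induction l generalizing s with
  | nil => exact ⟨hs, hs', by simp [walk]⟩
  | cons d l ih =>
    have hd := hl d (by simp)
    obtain ⟨h1, h2, h3⟩ := ih (s := (χ.shift f s.1 d, lam.tr s.2 s.1 (χ.shift f s.1 d)))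
      (χ.dom_shift f hs hd) (lam.rel_tr (χ.rel_shift f hs hd) hs') fun e he => hl e (by simp [he])
    refine ⟨h1, h2, ?_⟩
    rw [walk_cons, h3, χ.crd_shift f hs hd, List.sum_cons, add_assoc]

theorem walk_res {s : El M c' × El M c'} (hs : χ.dom f s.1) (hs' : N.rel s.1 s.2)
    {l : List (Fin χ.dim → Line R c')} (hl : ∀ d ∈ l, IsSmall R d) {c'' : C} (h : c'' ⟶ c') :
    Prod.map (res h) (res h) (lam.walk χ f s l) =
      lam.walk χ (h ≫ f) (Prod.map (res h) (res h) s) (l.map fun d i => lineRes R h (d i)) := by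
  induction l generalizing s with
  | nil => rfl
  | cons d l ih =>
    have hd := hl d (by simp)
    rw [walk_cons, ih (s := (χ.shift f s.1 d, lam.tr s.2 s.1 (χ.shift f s.1 d)))
      (χ.dom_shift f hs hd) (lam.rel_tr (χ.rel_shift f hs hd) hs') fun e he => hl e (by simp [he]),
      List.map_cons, walk_cons]
    congr 1
    simp only [Prod.map, lam.tr_res h (χ.rel_shift f hs hd) hs', χ.shift_res f hs hd]

end walk

theorem inSpec_squareIdeal {n k : ℕ} {c : C} {d : Fin n × Fin k → Line R c} :
    InSpec R (squareIdeal n (Fin k)) d ↔ ∀ a, IsSmall R fun i => d (a, i) := by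
  constructor
  · intro h a i j
    simpa using h _ (Ideal.subset_span ⟨a, i, j, rfl⟩)
  · intro h p hp
    have : squareIdeal n (Fin k) ≤ RingHom.ker (MvPolynomial.aeval (R := ℚ) d) := by
      rw [squareIdeal, Ideal.span_le]
      rintro _ ⟨a, i, j, rfl⟩
      simpa using h a i j
    exact this hp

theorem isSmall_of_inSpec_flatIdeal {k : ℕ} {c : C} {d : Fin 2 × Fin k → Line R c}
    (h : InSpec R (flatIdeal (Fin k)) d) :
    (∀ a, IsSmall R fun i => d (a, i)) ∧
      IsSmall R ((fun i => d (0, i)) + fun i => d (1, i)) := by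
  have h1 : ∀ a, IsSmall R fun i => d (a, i) := fun a i j => by
    simpa using h _ (Ideal.subset_span (Or.inl ⟨a, i, j, rfl⟩))
  refine ⟨h1, fun i j => ?_⟩
  have h2 : d (0, i) * d (1, j) + d (0, j) * d (1, i) = 0 := by
    simpa using h _ (Ideal.subset_span (Or.inr ⟨i, j, rfl⟩))
  simp only [Pi.add_apply]
  linear_combination h2 + h1 0 i j + h1 1 i j

/-! ### Path independence of transport -/

section KockLawvere

variable {c : C} (χ : Chart R N c) (hKL : KockLawvere R)

include hKL

/-- Transport along a path of given length is, in coordinates, a polynomial in the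
displacements. -/
theorem exists_polyVal_walk {s : El M c × El M c} (hs : χ.dom (𝟙 c) s.1) (hs' : N.rel s.1 s.2)
    (n : ℕ) (i : Fin χ.dim) :
    ∃ P : MvPolynomial (Fin n × Fin χ.dim) (Line R c), ∀ (c' : C) (f : c' ⟶ c)
      (d : Fin n → Fin χ.dim → Line R c'), (∀ a, IsSmall R (d a)) →
        χ.crd f (lam.walk χ f (Prod.map (res f) (res f) s) (List.ofFn d)).2 i =
          polyVal R f P fun p => d p.1 p.2 := by
  have hdom : ∀ {c' : C} (f : c' ⟶ c), χ.dom f (res f s.1) := fun f => by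
    simpa using χ.dom_res (𝟙 c) f hs
  -- Displacing and transporting commute with change of context, so the coordinate is a map from the
  -- infinitesimal object of `n`-tuples of small vectors to the line.
  obtain ⟨P, hP⟩ := (hKL _ _ (isWeilIdeal_squareIdeal n (Fin χ.dim)) c).1
    { val := fun {c'} f d _ => χ.crd f (lam.walk χ f (Prod.map (res f) (res f) s)
        (List.ofFn fun a j => d (a, j))).2 i
      val_res := fun {c' c''} f h d hd _ => by
        have hl : ∀ e ∈ List.ofFn fun a j => d (a, j), IsSmall R e := by
          intro e he
          obtain ⟨a, rfl⟩ := (List.mem_ofFn' _ _).1 he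
          exact inSpec_squareIdeal.1 hd a
        have hsf : N.rel (Prod.map (res f) (res f) s).1 (Prod.map (res f) (res f) s).2 :=
          N.rel_res f hs'
        have hw := lam.walk_spec χ f (s := Prod.map (res f) (res f) s) (hdom f) hsf hl
        have h1 := lam.walk_res χ f (s := Prod.map (res f) (res f) s) (hdom f) hsf hl h
        have h2 := congrFun (χ.crd_res f h (χ.dom_open f hw.1 hw.2.1)) i
        have h3 := congrArg Prod.snd h1
        simp only [Prod.map_snd] at h3
        rw [← h2, h3, List.map_ofFn]
        have h4 : Prod.map (res (h ≫ f)) (res (h ≫ f)) s =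
            Prod.map (res h) (res h) (Prod.map (res f) (res f) s) := by
          simp only [Prod.map, res_res]
        rw [h4]
        rfl }
  exact ⟨P, fun c' f d hd => hP c' f (fun p => d p.1 p.2) (inSpec_squareIdeal.2 hd)⟩

variable {lam} (hflat : lam.IsFlat)

include hflat

/-- Transport along two successive displacements does not depend on their order. -/
theorem walk_swap {s : El M c × El M c} (hs : χ.dom (𝟙 c) s.1) (hs' : N.rel s.1 s.2)
    {d e : Fin χ.dim → Line R c} (hd : IsSmall R d) (he : IsSmall R e) :
    lam.walk χ (𝟙 c) s [d, e] = lam.walk χ (𝟙 c) s [e, d] := by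
  obtain ⟨a1, a2, a3⟩ := lam.walk_spec χ (𝟙 c) hs hs' (l := [d, e]) (by simp [hd, he])
  obtain ⟨b1, b2, b3⟩ := lam.walk_spec χ (𝟙 c) hs hs' (l := [e, d]) (by simp [hd, he])
  refine Prod.ext (χ.crd_injective (𝟙 c) a1 b1 ?_) ?_
  · rw [a3, b3]
    simp [add_comm]
  refine χ.crd_injective (𝟙 c) (χ.dom_open _ a1 a2) (χ.dom_open _ b1 b2) (funext fun i => ?_)
  obtain ⟨P, hP⟩ := lam.exists_polyVal_walk χ hKL hs hs' 2 i
  -- Where `d + e` is small as well, the base point and its displacements by `d` and by `d + e` are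
  -- mutual neighbours. Flatness then identifies transport in either order with direct transport to
  -- the displacement by `d + e`, and uniqueness in Kock-Lawvere puts the antisymmetrization of `P`
  -- into the extended ideal.
  have hQ := (hKL _ _ (isWeilIdeal_flatIdeal (Fin χ.dim)) c).2
    (P - MvPolynomial.rename (Prod.map (Equiv.swap 0 1) id) P) fun c' f d hd => by
      obtain ⟨h1, h2⟩ := isSmall_of_inSpec_flatIdeal hd
      have hdom : χ.dom f (res f s.1) := by simpa using χ.dom_res (𝟙 c) f hs
      have key : ∀ e e' : Fin χ.dim → Line R c', IsSmall R e → IsSmall R e' →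
          IsSmall R (e + e') →
          (lam.walk χ f (Prod.map (res f) (res f) s) [e, e']).2 =
            lam.tr (res f s.2) (res f s.1) (χ.shift f (res f s.1) (e + e')) := by
        intro e e' he he' hee
        have hm := χ.dom_shift f hdom he
        have := tr_tr_of_isFlat hflat (χ.rel_shift f hdom he) (χ.rel_shift f hm he')
          (by rw [χ.shift_shift f hdom he he' hee]; exact χ.rel_shift f hdom hee)
          (N.rel_res f hs')
        rw [χ.shift_shift f hdom he he' hee] at this
        simp only [walk, List.foldl_cons, List.foldl_nil, Prod.map]
        rw [χ.shift_shift f hdom he he' hee, this]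
      have e1 := hP c' f (fun a i => d (a, i)) h1
      have e2 := hP c' f (fun a i => d (Equiv.swap 0 1 a, i)) fun a => h1 _
      simp only [List.ofFn_succ, List.ofFn_zero, Fin.succ_zero_eq_one, Equiv.swap_apply_left,
        Equiv.swap_apply_right] at e1 e2
      rw [key _ _ (h1 0) (h1 1) h2] at e1
      rw [key _ _ (h1 1) (h1 0) (by rw [add_comm]; exact h2), add_comm, e1] at e2
      rw [polyVal, MvPolynomial.eval₂_sub, MvPolynomial.eval₂_rename]
      exact sub_eq_zero.2 e2
  have hs1 : Prod.map (res (𝟙 c)) (res (𝟙 c)) s = s := by simp only [Prod.map, res_id]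
  -- The antisymmetrization is symmetric on all pairs of small vectors, so twice its value is zero;
  -- here `d + e` need not be small.
  have h := eval₂_swap_of_mem_flatIdeal (lineRes R (𝟙 c)).toRingHom d e hd he _ hQ
  have e1 := hP c (𝟙 c) ![d, e] (by simp [Fin.forall_fin_two, hd, he])
  have e2 := hP c (𝟙 c) ![e, d] (by simp [Fin.forall_fin_two, hd, he])
  rw [hs1] at e1 e2
  simp only [MvPolynomial.eval₂_sub, MvPolynomial.eval₂_rename] at h
  have c1 : (fun p : Fin 2 × Fin χ.dim => ![d, e] p.1 p.2) ∘ Prod.map (Equiv.swap 0 1) id =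
      fun p => ![e, d] p.1 p.2 := by
    funext ⟨a, i⟩
    fin_cases a <;> simp
  have c2 : (fun p : Fin 2 × Fin χ.dim => ![e, d] p.1 p.2) ∘ Prod.map (Equiv.swap 0 1) id =
      fun p => ![d, e] p.1 p.2 := by
    funext ⟨a, i⟩
    fin_cases a <;> simp
  rw [c1, c2] at h
  have l1 : List.ofFn ![d, e] = [d, e] := by simp
  have l2 : List.ofFn ![e, d] = [e, d] := by simp
  rw [l1] at e1
  rw [l2] at e2
  rw [e1, e2, polyVal, polyVal]
  have h2 : IsUnit (2 : Line R c) := by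
    have h := (IsUnit.mk0 (2 : ℚ) two_ne_zero).map (algebraMap ℚ (Line R c))
    rwa [map_ofNat] at h
  refine h2.mul_left_cancel ?_
  linear_combination h

theorem walk_perm {l l' : List (Fin χ.dim → Line R c)} (h : l.Perm l')
    (hl : ∀ d ∈ l, IsSmall R d) {s : El M c × El M c} (hs : χ.dom (𝟙 c) s.1)
    (hs' : N.rel s.1 s.2) : lam.walk χ (𝟙 c) s l = lam.walk χ (𝟙 c) s l' := by
  induction h generalizing s with
  | nil => rfl
  | cons d _ ih =>
    have hd := hl d (by simp)
    exact ih (fun e he => hl e (by simp [he])) (χ.dom_shift _ hs hd)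
      (lam.rel_tr (χ.rel_shift _ hs hd) hs')
  | swap d e l =>
    have := walk_swap χ hKL hflat hs hs' (hl e (by simp)) (hl d (by simp))
    simp only [walk, List.foldl_cons, List.foldl_nil] at this ⊢
    rw [this]
  | trans h1 _ ih1 ih2 =>
    rw [ih1 hl hs hs', ih2 (fun d hd => hl d (h1.mem_iff.2 hd)) hs hs']

/-- The polynomial describing `n` steps is permutation invariant on small vectors by `walk_perm`, so
it sees only their sum. -/
theorem walk_ofFn_eq {n : ℕ} {d d' : Fin n → Fin χ.dim → Line R c} (hd : ∀ a, IsSmall R (d a))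
    (hd' : ∀ a, IsSmall R (d' a)) (hsum : ∑ a, d a = ∑ a, d' a) {s : El M c × El M c}
    (hs : χ.dom (𝟙 c) s.1) (hs' : N.rel s.1 s.2) :
    (lam.walk χ (𝟙 c) s (List.ofFn d)).2 = (lam.walk χ (𝟙 c) s (List.ofFn d')).2 := by
  have hl : ∀ {d : Fin n → Fin χ.dim → Line R c}, (∀ a, IsSmall R (d a)) →
      ∀ e ∈ List.ofFn d, IsSmall R e := by
    intro d hd e he
    obtain ⟨a, rfl⟩ := (List.mem_ofFn' _ _).1 he
    exact hd a
  obtain ⟨a1, a2, -⟩ := lam.walk_spec χ (𝟙 c) hs hs' (hl hd)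
  obtain ⟨b1, b2, -⟩ := lam.walk_spec χ (𝟙 c) hs hs' (hl hd')
  refine χ.crd_injective (𝟙 c) (χ.dom_open _ a1 a2) (χ.dom_open _ b1 b2) (funext fun i => ?_)
  obtain ⟨P, hP⟩ := lam.exists_polyVal_walk χ hKL hs hs' n i
  have hs1 : Prod.map (res (𝟙 c)) (res (𝟙 c)) s = s := by simp only [Prod.map, res_id]
  have hperm : ∀ {d : Fin n → Fin χ.dim → Line R c}, (∀ a, IsSmall R (d a)) →
      ∀ π : Equiv.Perm (Fin n), polyVal R (𝟙 c) P (fun p => d (π p.1) p.2) =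
        polyVal R (𝟙 c) P (fun p => d p.1 p.2) := by
    intro d hd π
    have h1 := hP c (𝟙 c) (d ∘ π) fun a => hd _
    rw [hs1, walk_perm χ hKL hflat (Equiv.Perm.ofFn_comp_perm π d) (hl fun a => hd _) hs hs'] at h1
    rw [← hP c (𝟙 c) d hd, hs1]
    exact h1.symm
  have e1 := hP c (𝟙 c) d hd
  have e2 := hP c (𝟙 c) d' hd'
  rw [hs1] at e1 e2
  rw [e1, e2]
  refine eval₂_eq_of_sum_eq _ d d' hd hd' (fun j => ?_) P (hperm hd) (hperm hd')
  simpa using congrFun hsum j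

omit hKL hflat in
-- A path starting in a formally open domain stays there, so its coordinate differences recover it.
theorem walk_ofFn_crd_sub {p : ℕ → El M c} (hp : ∀ i, N.rel (p i) (p (i + 1)))
    (h0 : χ.dom (𝟙 c) (p 0)) (z : El M c) (n : ℕ) :
    lam.walk χ (𝟙 c) (p 0, z)
      (List.ofFn fun a : Fin n => χ.crd (𝟙 c) (p (a + 1)) - χ.crd (𝟙 c) (p a)) =
        (p n, lam.trSeq p z n) := by
  have hdom : ∀ i, χ.dom (𝟙 c) (p i) := fun i => by
    induction i with
    | zero => exact h0
    | succ i ih => exact χ.dom_open _ ih (hp i)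
  induction n with
  | zero => rfl
  | succ n ih =>
    rw [List.ofFn_succ', List.concat_eq_append, walk, List.foldl_append]
    simp only [Fin.val_castSucc, Fin.val_last]
    rw [walk] at ih
    rw [ih]
    simp only [List.foldl_cons, List.foldl_nil, χ.shift_crd_sub (𝟙 c) (hdom n) (hp n), trSeq]

/-- The displacements telescope: for both paths their sum is the difference of the coordinates of
the common end points. -/
theorem trSeq_eq_of_chart {p p' : ℕ → El M c} (hp : ∀ i, N.rel (p i) (p (i + 1)))
    (hp' : ∀ i, N.rel (p' i) (p' (i + 1))) (h0 : p 0 = p' 0) {n : ℕ} (hn : p n = p' n)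
    (hdom : χ.dom (𝟙 c) (p 0)) {z : El M c} (hz : N.rel (p 0) z) :
    lam.trSeq p z n = lam.trSeq p' z n := by
  have h1 := walk_ofFn_crd_sub (lam := lam) χ hp hdom z n
  have h2 := walk_ofFn_crd_sub (lam := lam) χ hp' (h0 ▸ hdom) z n
  have hd : ∀ {p : ℕ → El M c}, (∀ i, N.rel (p i) (p (i + 1))) → χ.dom (𝟙 c) (p 0) → ∀ i,
      IsSmall R (χ.crd (𝟙 c) (p (i + 1)) - χ.crd (𝟙 c) (p i)) := by
    intro p hp h0 i
    have hdom : ∀ i, χ.dom (𝟙 c) (p i) := fun i => by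
      induction i with
      | zero => exact h0
      | succ i ih => exact χ.dom_open _ ih (hp i)
    exact (χ.rel_iff_crd _ (hdom i) (hdom (i + 1))).1 (hp i)
  have h := walk_ofFn_eq χ hKL hflat (fun a : Fin n => hd hp hdom a)
    (fun a : Fin n => hd hp' (h0 ▸ hdom) a) ?_ (s := (p 0, z)) hdom hz
  · rw [h1, h0, h2] at h
    exact h
  · rw [Fin.sum_univ_eq_sum_range (fun i => χ.crd (𝟙 c) (p (i + 1)) - χ.crd (𝟙 c) (p i)),
      Fin.sum_univ_eq_sum_range (fun i => χ.crd (𝟙 c) (p' (i + 1)) - χ.crd (𝟙 c) (p' i)),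
      Finset.sum_range_sub fun i => χ.crd (𝟙 c) (p i),
      Finset.sum_range_sub fun i => χ.crd (𝟙 c) (p' i), h0, hn]

/-- Transport along a path depends only on the end points of the path. -/
theorem trSeq_eq_of_isFlat (hM : Presieve.IsSheaf J M) (hN : IsFormalManifold R N)
    {p p' : ℕ → El M c} (hp : ∀ i, N.rel (p i) (p (i + 1)))
    (hp' : ∀ i, N.rel (p' i) (p' (i + 1))) (h0 : p 0 = p' 0) {n : ℕ} (hn : p n = p' n)
    {z : El M c} (hz : N.rel (p 0) z) :
    lam.trSeq p z n = lam.trSeq p' z n := by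
  obtain ⟨S, hS, h⟩ := hN c (p 0)
  refine ext_of_covering hM S hS fun c' g hg => ?_
  obtain ⟨χ, hχ⟩ := h c' g hg
  rw [lam.res_trSeq g hp hz, lam.res_trSeq g hp' (h0 ▸ hz)]
  exact trSeq_eq_of_chart χ hKL hflat (fun i => N.rel_res g (hp i))
    (fun i => N.rel_res g (hp' i)) (congrArg _ h0) (congrArg _ hn) hχ (N.rel_res g hz)

end KockLawvere

end AffineConnection

end SDG

namespace SDG

variable {C : Type u} [Category.{v} C] {J : GrothendieckTopology C}
  {R : Cᵒᵖ ⥤ CommAlgCat.{r} ℚ} {M : Cᵒᵖ ⥤ Type w} {N : NeighbourRelation J M}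

/-! ### Grids -/

/-- Extension of a finite sequence by repeating its last term. -/
def extendPath {X : Type*} {m : ℕ} (p : Fin (m + 1) → X) (i : ℕ) : X :=
  p ⟨min i m, by omega⟩

theorem extendPath_of_le {X : Type*} {m : ℕ} (p : Fin (m + 1) → X) {i : ℕ} (hi : i ≤ m) :
    extendPath p i = p ⟨i, by omega⟩ := by
  simp [extendPath, hi]

theorem extendPath_of_ge {X : Type*} {m : ℕ} (p : Fin (m + 1) → X) {i : ℕ} (hi : m ≤ i) :
    extendPath p i = p (Fin.last m) := by
  simp only [extendPath, min_eq_right hi]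
  rfl

theorem extendPath_val {X : Type*} {m : ℕ} (p : Fin (m + 1) → X) (i : Fin (m + 1)) :
    extendPath p i = p i :=
  extendPath_of_le p (Nat.lt_succ_iff.1 i.2)

namespace NeighbourRelation

variable {c : C} {m : ℕ} {p : Fin (m + 1) → El M c} {x y : El M c}

theorem IsPath.rel_extendPath (h : N.IsPath p x y) (i : ℕ) :
    N.rel (extendPath p i) (extendPath p (i + 1)) := by
  rcases lt_or_ge i m with hi | hi
  · rw [extendPath_of_le p hi.le, extendPath_of_le p hi]
    exact h.step ⟨i, hi⟩
  · rw [extendPath_of_ge p hi, extendPath_of_ge p (by omega)]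
    exact N.refl _

theorem IsPath.extendPath_zero (h : N.IsPath p x y) : extendPath p 0 = x := by
  rw [extendPath_of_le p (Nat.zero_le m)]
  exact h.dom

theorem IsPath.extendPath_of_ge (h : N.IsPath p x y) {i : ℕ} (hi : m ≤ i) :
    extendPath p i = y := by
  rw [SDG.extendPath_of_ge p hi, h.codom]

theorem IsPath.res (h : N.IsPath p x y) {c' : C} (g : c' ⟶ c) :
    N.IsPath (fun i => res g (p i)) (res g x) (res g y) :=
  ⟨congrArg _ h.dom, congrArg _ h.codom, fun i => N.rel_res g (h.step i)⟩

theorem isPath_const (x : El M c) : N.IsPath (fun _ : Fin (0 + 1) => x) x x :=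
  ⟨rfl, rfl, fun i => i.elim0⟩

theorem isPath_pair (h : N.rel x y) : N.IsPath (![x, y] : Fin (1 + 1) → El M c) x y :=
  ⟨rfl, rfl, fun i => by fin_cases i; exact h⟩

theorem IsPath.rev (h : N.IsPath p x y) : N.IsPath (fun i => p i.rev) y x := by
  refine ⟨by simpa using h.codom, by simpa using h.dom, fun i => ?_⟩
  have := N.symm (h.step i.rev)
  rwa [← Fin.rev_castSucc, ← Fin.rev_succ] at this

/-- Equality of elements of a path connected sheaf can be checked in the contexts in which given
points are joined by paths. -/
theorem PathConnected.ext (hpath : N.PathConnected) (hM : Presieve.IsSheaf J M) (x y z : El M c)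
    {w w' : El M c}
    (h : ∀ (c' : C) (f : c' ⟶ c) (m n : ℕ) (zs : Fin (m + 1) → El M c')
      (ys : Fin (n + 1) → El M c'), N.IsPath zs (SDG.res f x) (SDG.res f z) →
      N.IsPath ys (SDG.res f x) (SDG.res f y) → SDG.res f w = SDG.res f w') : w = w' := by
  refine ext_of_covering hM _ (J.intersection_covering (hpath x z) (hpath x y)) ?_
  rintro c' f ⟨⟨m, zs, hzs⟩, n, ys, hys⟩
  exact h c' f m n zs ys hzs hys

end NeighbourRelation

namespace AffineConnection

variable (lam : AffineConnection N)

/-- The grid spanned by two infinite sequences. -/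
noncomputable def grid {c : C} (zs ys : ℕ → El M c) : ℕ → ℕ → El M c
  | 0 => ys
  | i + 1 => lam.trSeq (grid zs ys i) (zs (i + 1))

section

variable {c : C} {zs ys : ℕ → El M c}

theorem grid_zero_right (h0 : zs 0 = ys 0) (i : ℕ) : lam.grid zs ys i 0 = zs i := by
  cases i with
  | zero => exact h0.symm
  | succ i => rfl

theorem eq_grid {g : ℕ → ℕ → El M c} (hys : ∀ j, g 0 j = ys j) (hzs : ∀ i, g i 0 = zs i)
    (hg : ∀ i j, g (i + 1) (j + 1) = lam.tr (g (i + 1) j) (g i j) (g i (j + 1))) (i j : ℕ) :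
    g i j = lam.grid zs ys i j := by
  induction i generalizing j with
  | zero => exact hys j
  | succ i ih =>
    induction j with
    | zero => exact hzs _
    | succ j ihj => rw [hg, ihj, ih, ih]; rfl

variable (hz : ∀ i, N.rel (zs i) (zs (i + 1))) (hy : ∀ j, N.rel (ys j) (ys (j + 1)))
  (h0 : zs 0 = ys 0)

include hz hy h0

theorem rel_grid_succ_right (i j : ℕ) : N.rel (lam.grid zs ys i j) (lam.grid zs ys i (j + 1)) := by
  induction i generalizing j with
  | zero => exact hy j
  | succ i ih =>
    refine lam.rel_trSeq_succ ih ?_ j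
    rw [lam.grid_zero_right h0]
    exact hz i

omit hy in
theorem rel_grid_zero (i : ℕ) : N.rel (lam.grid zs ys i 0) (zs (i + 1)) := by
  rw [lam.grid_zero_right h0]
  exact hz i

theorem rel_grid_succ_left (i j : ℕ) : N.rel (lam.grid zs ys i j) (lam.grid zs ys (i + 1) j) :=
  lam.rel_trSeq (lam.rel_grid_succ_right hz hy h0 i) (lam.rel_grid_zero hz h0 i) j

theorem res_grid {c' : C} (g : c' ⟶ c) (i j : ℕ) :
    res g (lam.grid zs ys i j) = lam.grid (fun i => res g (zs i)) (fun j => res g (ys j)) i j := by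
  induction i generalizing j with
  | zero => rfl
  | succ i ih =>
    rw [grid, lam.res_trSeq g (lam.rel_grid_succ_right hz hy h0 i)
      (lam.rel_grid_zero hz h0 i), grid]
    congr 1
    funext k
    exact ih k

/-- By symmetry of the connection, the transposed array satisfies the recursion that determines the
grid. -/
theorem grid_comm {lam : AffineConnection N} (hsymm : lam.IsSymmetric) (i j : ℕ) :
    lam.grid zs ys i j = lam.grid ys zs j i := by
  refine (lam.eq_grid (g := fun i j => lam.grid ys zs j i) (lam.grid_zero_right h0.symm)
    (fun i => rfl) (fun i j => ?_) i j).symm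
  change lam.tr (lam.grid ys zs (j + 1) i) (lam.grid ys zs j i) (lam.grid ys zs j (i + 1)) = _
  exact tr_comm hsymm (lam.rel_grid_succ_right hy hz h0.symm j i)
    (lam.rel_grid_succ_left hy hz h0.symm j i)

omit hz hy h0 in
-- Repeating the last point of a path adds only trivial transports `[zxx] = z`, which allows paths
-- of different lengths to be compared. No neighbour hypotheses are needed, as the default value of
-- `tr` is also `z`.
theorem grid_of_ge_right {n : ℕ} (hn : ∀ j, n ≤ j → ys j = ys n) (i j : ℕ) (hj : n ≤ j) :
    lam.grid zs ys i j = lam.grid zs ys i n := by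
  induction i generalizing j with
  | zero => exact hn j hj
  | succ i ih =>
    induction j, hj using Nat.le_induction with
    | base => rfl
    | succ j hj ihj =>
      rw [← ihj]
      change lam.tr (lam.grid zs ys (i + 1) j) (lam.grid zs ys i j) (lam.grid zs ys i (j + 1)) = _
      rw [ih j hj, ih (j + 1) (by omega), tr_self]

omit hz hy h0 in
/-- The codomain of a grid depends only on the end points of its second path. -/
theorem grid_congr_right (hKL : KockLawvere R) (hM : Presieve.IsSheaf J M)
    (hN : IsFormalManifold R N) {lam : AffineConnection N} (hflat : lam.IsFlat)
    (hz : ∀ i, N.rel (zs i) (zs (i + 1))) (hy : ∀ j, N.rel (ys j) (ys (j + 1)))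
    (h0 : zs 0 = ys 0) {ys' : ℕ → El M c} (hy' : ∀ j, N.rel (ys' j) (ys' (j + 1)))
    (h0' : zs 0 = ys' 0) {n : ℕ} (hn : ys n = ys' n) (i : ℕ) :
    lam.grid zs ys i n = lam.grid zs ys' i n := by
  induction i with
  | zero => exact hn
  | succ i ih =>
    -- Both rows of index `i` start at `zs i` and, by induction, agree at index `n`; the next rows
    -- transport the same point along them.
    refine trSeq_eq_of_isFlat hKL hflat hM hN (lam.rel_grid_succ_right hz hy h0 i)
      (lam.rel_grid_succ_right hz hy' h0' i) ?_ ih (lam.rel_grid_zero hz h0 i)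
    rw [lam.grid_zero_right h0, lam.grid_zero_right h0']

end

/-! ### Grids spanned by finite paths -/

section finite

variable {c : C} {m n : ℕ} {zs : Fin (m + 1) → El M c} {ys : Fin (n + 1) → El M c}

theorem IsGrid.eq_grid {lam : AffineConnection N} {g : Fin (m + 1) → Fin (n + 1) → El M c}
    (h : lam.IsGrid zs ys g) (i : Fin (m + 1)) (j : Fin (n + 1)) :
    g i j = lam.grid (extendPath zs) (extendPath ys) i j := by
  induction i using Fin.induction generalizing j with
  | zero => rw [h.top, Fin.val_zero, grid, extendPath_val]
  | succ i ih =>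
    induction j using Fin.induction with
    | zero =>
      rw [h.left, Fin.val_succ, Fin.val_zero, grid, trSeq, ← Fin.val_succ, extendPath_val]
    | succ j ihj =>
      obtain ⟨hy, hz, e⟩ := h.step i j
      rw [e, ← lam.tr_eq, ihj, ih, ih]
      rfl

theorem isGrid_grid {x y z : El M c} (hzs : N.IsPath zs x z) (hys : N.IsPath ys x y) :
    lam.IsGrid zs ys fun i j => lam.grid (extendPath zs) (extendPath ys) i j := by
  have h0 : extendPath zs 0 = extendPath ys 0 := by rw [hzs.extendPath_zero, hys.extendPath_zero]
  have hy := lam.rel_grid_succ_right hzs.rel_extendPath hys.rel_extendPath h0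
  have hz := lam.rel_grid_succ_left hzs.rel_extendPath hys.rel_extendPath h0
  refine ⟨fun i => ?_, fun j => ?_, fun i j => ⟨hy _ _, hz _ _, ?_⟩⟩
  · rw [Fin.val_zero, lam.grid_zero_right h0, extendPath_val]
  · rw [Fin.val_zero, grid, extendPath_val]
  · rw [← lam.tr_eq]
    rfl

/-- The codomain of the grid spanned by two paths depends only on the end points of the paths. -/
theorem grid_eq_of_isPath (hKL : KockLawvere R) (hM : Presieve.IsSheaf J M)
    (hN : IsFormalManifold R N) {lam : AffineConnection N} (hsymm : lam.IsSymmetric)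
    (hflat : lam.IsFlat) {x y z : El M c} (hzs : N.IsPath zs x z) (hys : N.IsPath ys x y)
    {m' n' : ℕ} {zs' : Fin (m' + 1) → El M c} {ys' : Fin (n' + 1) → El M c}
    (hzs' : N.IsPath zs' x z) (hys' : N.IsPath ys' x y) :
    lam.grid (extendPath zs) (extendPath ys) m n =
      lam.grid (extendPath zs') (extendPath ys') m' n' := by
  -- Only the second path is varied here, after padding to the common length `max n n'`; transposing
  -- the grid later takes care of the first path.
  have key : ∀ {m n : ℕ} {zs : Fin (m + 1) → El M c} {ys : Fin (n + 1) → El M c} {y z : El M c},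
      N.IsPath zs x z → N.IsPath ys x y → ∀ {n' : ℕ} {ys' : Fin (n' + 1) → El M c},
      N.IsPath ys' x y → lam.grid (extendPath zs) (extendPath ys) m n =
        lam.grid (extendPath zs) (extendPath ys') m n' := by
    intro m n zs ys y z hzs hys n' ys' hys'
    rw [← lam.grid_of_ge_right (n := n) (fun j hj => by
        rw [hys.extendPath_of_ge hj, hys.extendPath_of_ge le_rfl]) m (max n n') (le_max_left _ _),
      ← lam.grid_of_ge_right (n := n') (fun j hj => by
        rw [hys'.extendPath_of_ge hj, hys'.extendPath_of_ge le_rfl]) m (max n n')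
        (le_max_right _ _)]
    refine grid_congr_right hKL hM hN hflat hzs.rel_extendPath hys.rel_extendPath ?_
      hys'.rel_extendPath ?_ ?_ m
    · rw [hzs.extendPath_zero, hys.extendPath_zero]
    · rw [hzs.extendPath_zero, hys'.extendPath_zero]
    · rw [hys.extendPath_of_ge (le_max_left _ _), hys'.extendPath_of_ge (le_max_right _ _)]
  have h0 : extendPath zs 0 = extendPath ys' 0 := by
    rw [hzs.extendPath_zero, hys'.extendPath_zero]
  have h0' : extendPath ys' 0 = extendPath zs' 0 := by
    rw [hzs'.extendPath_zero, hys'.extendPath_zero]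
  rw [key hzs hys hys', grid_comm hzs.rel_extendPath hys'.rel_extendPath h0 hsymm,
    key hys' hzs hzs', grid_comm hys'.rel_extendPath hzs'.rel_extendPath h0' hsymm]

end finite

/-- The codomains of grids are the values of a global operation. -/
theorem exists_globalOp_eq_grid (hKL : KockLawvere R) (hM : Presieve.IsSheaf J M)
    (hN : IsFormalManifold R N) (hpath : N.PathConnected) {lam : AffineConnection N}
    (hsymm : lam.IsSymmetric) (hflat : lam.IsFlat) :
    ∃ add : GlobalOp M, ∀ {c : C} {x y z : El M c} {m n : ℕ} {zs : Fin (m + 1) → El M c}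
      {ys : Fin (n + 1) → El M c}, N.IsPath zs x z → N.IsPath ys x y →
        add.op z x y = lam.grid (extendPath zs) (extendPath ys) m n := by
  -- The value is glued over the sieve of contexts in which both paths exist. Path independence
  -- makes the local values compatible, and the quantification over all later contexts `f` is what
  -- later yields naturality.
  have hex : ∀ {c : C} (z x y : El M c), ∃ w : El M c, ∀ (c' : C) (f : c' ⟶ c) (m n : ℕ)
      (zs : Fin (m + 1) → El M c') (ys : Fin (n + 1) → El M c'),
      N.IsPath zs (res f x) (res f z) → N.IsPath ys (res f x) (res f y) →
        res f w = lam.grid (extendPath zs) (extendPath ys) m n := by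
    intro c z x y
    have hS := J.intersection_covering (hpath x z) (hpath x y)
    have hloc : ∀ {c' : C} (f : c' ⟶ c), (N.pathSieve x z ⊓ N.pathSieve x y) f →
        ∃ w : El M c', ∀ (m n : ℕ) (zs : Fin (m + 1) → El M c') (ys : Fin (n + 1) → El M c'),
          N.IsPath zs (res f x) (res f z) → N.IsPath ys (res f x) (res f y) →
            w = lam.grid (extendPath zs) (extendPath ys) m n := by
      rintro c' f ⟨⟨m, zs, hzs⟩, n, ys, hys⟩
      exact ⟨_, fun m' n' zs' ys' hzs' hys' =>
        grid_eq_of_isPath hKL hM hN hsymm hflat hzs hys hzs' hys'⟩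
    choose t ht using @hloc
    obtain ⟨w, hw, -⟩ := hM _ hS (fun c' f hf => t f hf) (by
      refine (Presieve.compatible_iff_sieveCompatible _).2 fun c' c'' f g hf => ?_
      obtain ⟨⟨m, zs, hzs⟩, n, ys, hys⟩ := id hf
      have h0 : extendPath zs 0 = extendPath ys 0 := by
        rw [hzs.extendPath_zero, hys.extendPath_zero]
      have h1 := hzs.res g
      have h2 := hys.res g
      rw [res_res, res_res] at h1 h2
      rw [ht (g ≫ f) _ m n _ _ h1 h2, ht f hf m n zs ys hzs hys]
      exact (lam.res_grid hzs.rel_extendPath hys.rel_extendPath h0 g m n).symm)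
    refine ⟨w, fun c' f m n zs ys hzs hys => ?_⟩
    have hf : (N.pathSieve x z ⊓ N.pathSieve x y) f := ⟨⟨m, zs, hzs⟩, n, ys, hys⟩
    exact (hw f hf).trans (ht f hf m n zs ys hzs hys)
  choose op hop using @hex
  refine ⟨⟨op, fun {c c'} g z x y => ?_⟩, fun {c x y z m n zs ys} hzs hys => ?_⟩
  · refine hpath.ext hM (res g x) (res g y) (res g z) fun c'' f m n zs ys hzs hys => ?_
    rw [hop _ _ _ c'' f m n zs ys hzs hys, res_res]
    rw [res_res, res_res] at hzs hys
    exact hop _ _ _ c'' _ m n zs ys hzs hys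
  · have := hop z x y c (𝟙 c) m n zs ys (by simpa only [res_id] using hzs)
      (by simpa only [res_id] using hys)
    rwa [res_id] at this

end AffineConnection

end SDG

theorem proposition3p2 {C : Type u} [Category.{v} C] (J : GrothendieckTopology C)
    (R : Cᵒᵖ ⥤ CommAlgCat.{r} ℚ) (hR : Presieve.IsSheaf J (R ⋙ forget (CommAlgCat.{r} ℚ)))
    (hKL : SDG.KockLawvere R)
    (M : Cᵒᵖ ⥤ Type w) (hM : Presieve.IsSheaf J M)
    (N : SDG.NeighbourRelation J M) (hN : SDG.IsFormalManifold R N) (hpath : N.PathConnected)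
    (lam : SDG.AffineConnection N) (hsymm : lam.IsSymmetric) (hflat : lam.IsFlat) :
    ∃ add : SDG.GlobalOp M,
      (lam.IsGridSum add ∧ ∀ add' : SDG.GlobalOp M, lam.IsGridSum add' → add' = add) ∧
      (∀ (c : C) (z x y : SDG.El M c), add.op z x y = add.op y x z) ∧
      (∀ (c : C) (x y : SDG.El M c), add.op x x y = y ∧ add.op y x x = y) ∧
      ∃ big : SDG.AffineConnection N.infinity,
        (∀ (c : C) (z x y : SDG.El M c),
          big.op z x y (hpath x y) (hpath x z) = add.op z x y) ∧
        big.IsSymmetric ∧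
        (∀ (c : C) (z x y : SDG.El M c) (hy : N.rel x y) (hz : N.rel x z),
          big.op z x y (hpath x y) (hpath x z) = lam.op z x y hy hz) := by
  obtain ⟨add, hadd⟩ := SDG.AffineConnection.exists_globalOp_eq_grid hKL hM hN hpath hsymm hflat
  have hcomm : ∀ (c : C) (z x y : SDG.El M c), add.op z x y = add.op y x z := fun c z x y => by
    refine hpath.ext hM x y z fun c' f m n zs ys hzs hys => ?_
    rw [add.op_res, add.op_res, hadd hzs hys, hadd hys hzs]
    exact SDG.AffineConnection.grid_comm hzs.rel_extendPath hys.rel_extendPath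
      (hzs.extendPath_zero.trans hys.extendPath_zero.symm) hsymm m n
  have hunit : ∀ (c : C) (x y : SDG.El M c), add.op x x y = y := fun c x y => by
    refine hpath.ext hM x y x fun c' f m n zs ys _ hys => ?_
    -- A constant path of length zero spans a grid consisting of the single row `ys`.
    rw [add.op_res, hadd (N.isPath_const _) hys]
    exact hys.extendPath_of_ge le_rfl
  have hinv : ∀ (c : C) (x y z : SDG.El M c), add.op (add.op z x y) y x = z := fun c x y z => by
    refine hpath.ext hM x y z fun c' f m n zs ys hzs hys => ?_
    have h0 := hzs.extendPath_zero.trans hys.extendPath_zero.symm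
    have hr := lam.rel_grid_succ_right hzs.rel_extendPath hys.rel_extendPath h0
    have hl := lam.rel_grid_succ_left hzs.rel_extendPath hys.rel_extendPath h0
    rw [add.op_res, add.op_res, hadd hzs hys]
    -- The last column leads from `y` to `z +ₓ y`. Together with the reversed path from `y` to `x`
    -- it spans the same grid with its rows read backwards, each cell being inverted by `[[zxy]yx] =
    -- z`. The codomain of this reversed grid is the end of the first column, namely `z`.
    have hcol : N.IsPath
        (fun i : Fin (m + 1) => lam.grid (SDG.extendPath zs) (SDG.extendPath ys) i n)
        (SDG.res f y) (lam.grid (SDG.extendPath zs) (SDG.extendPath ys) m n) :=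
      ⟨hys.extendPath_of_ge le_rfl, rfl, fun i => hl i n⟩
    have hg : lam.IsGrid
        (fun i : Fin (m + 1) => lam.grid (SDG.extendPath zs) (SDG.extendPath ys) i n)
        (fun j => ys j.rev)
        (fun i j => lam.grid (SDG.extendPath zs) (SDG.extendPath ys) i j.rev) := by
      refine ⟨fun i => by simp, fun j => SDG.extendPath_val ys j.rev, fun i j => ?_⟩
      rw [Fin.rev_castSucc, Fin.rev_succ]
      refine ⟨N.symm (hr _ _), hl _ _, ?_⟩
      rw [← lam.tr_eq]
      exact (lam.tr_tr_cancel (hr _ _) (hl _ _)).symm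
    rw [hadd hcol hys.rev]
    have h := hg.eq_grid (Fin.last m) (Fin.last n)
    simp only [Fin.val_last, Fin.rev_last, Fin.val_zero] at h
    rw [← h, lam.grid_zero_right h0, hzs.extendPath_of_ge le_rfl]
  refine ⟨add, ⟨fun z x y m n zs ys hzs hys => ⟨_, lam.isGrid_grid hzs hys, ?_⟩,
    fun add' h' => ?_⟩, hcomm, fun c x y => ⟨hunit c x y, (hcomm c y x x).trans (hunit c x y)⟩,
    { op := fun z x y _ _ => add.op z x y
      op_res := fun g z x y _ _ => add.op_res g z x y
      rel_right := fun _ _ _ _ _ => hpath _ _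
      rel_left := fun _ _ _ _ _ => hpath _ _
      unit_right := fun z x _ => (hcomm _ z x x).trans (hunit _ x z)
      unit_left := fun x y _ => hunit _ x y
      inversion := fun z x y _ _ => hinv _ x y z }, fun c z x y => rfl,
    fun z x y _ _ => hcomm _ z x y, fun c z x y hy hz => ?_⟩
  · rw [hadd hzs hys, Fin.val_last, Fin.val_last]
  · ext c z x y
    -- Paths exist locally, and any grid they span is the recursively defined one, so the value is
    -- forced.
    refine hpath.ext hM x y z fun c' f m n zs ys hzs hys => ?_
    obtain ⟨g, hg, e⟩ := h' _ _ _ zs ys hzs hys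
    rw [add'.op_res, add.op_res, hadd hzs hys, ← e, hg.eq_grid, Fin.val_last, Fin.val_last]
  · rw [← lam.tr_eq hy hz]
    exact hadd (N.isPath_pair hz) (N.isPath_pair hy)
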